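/- For a positive integer $n$ let $\Omega_n=\{0,1,-1,2,-2,\dots,n,-n\}$, and let $\mathfrak{B}_n$ be the group of signed permutations of length $n$, i.e. of bijections $\pi:\Omega_n\to\Omega_n$ with $\pi(-a)=-\pi(a)$ for all $a\in\Omega_n$. For $\pi\in\mathfrak{B}_n$ let $\mathrm{des}^B(\pi)=|\{i\in\{0,1,\dots,n-1\} : \pi(i)>\pi(i+1)\}|$ be the number of descents with respect to the natural order on $\mathbb{Z}$ (note that $\pi(0)=0$). For an integer $k$ let $I^{\overline{B}}_{n,k}$ be the number of signed involutions $\pi\in\mathfrak{B}_n$ (i.e. $\pi^{-1}=\pi$) with $\mathrm{des}^B(\pi)=k$. Theorem. For all integers $n\ge 3$ and $k\ge 0$, $$ \begin{aligned} n\,I^{\overline{B}}_{n,k}={}&(2k+1)\,I^{\overline{B}}_{n-1,k}+(2n-2k+1)\,I^{\overline{B}}_{n-1,k-1}+\bigl(n-1+2k(k+1)\bigr)I^{\overline{B}}_{n-2,k}\\ &+\bigl(2(n-1)+4(n-k-1)(k-1)\bigr)I^{\overline{B}}_{n-2,k-1}\\ &+\bigl((2n-3)(n-1)+2(k-2)(k-2n+1)\bigr)I^{\overline{B}}_{n-2,k-2},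 \end{aligned} $$ where $I^{\overline{B}}_{1,0}=1$, $I^{\overline{B}}_{1,1}=1$, $I^{\overline{B}}_{2,0}=1$, $I^{\overline{B}}_{2,1}=4$, $I^{\overline{B}}_{2,2}=1$, and $I^{\overline{B}}_{n,k}=0$ for all $n\ge 1$ and $k<0$. -/

import Mathlib

namespace SignedPerm

/-- The set `{0, 1, -1, 2, -2, …, n, -n}`. -/
abbrev Omega (n : ℕ) : Type := {a : ℤ // a ∈ Finset.Icc (-(n : ℤ)) (n : ℤ)}

/-- Negation `a ↦ -a` on `Omega n`. -/
def Omega.neg {n : ℕ} (a : Omega n) : Omega n :=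
  ⟨-a.1, by have h := Finset.mem_Icc.1 a.2; exact Finset.mem_Icc.2 ⟨by lia, by lia⟩⟩

/-- The element `m` of `Omega n`, for a natural number `m ≤ n`. -/
def Omega.ofNat {n : ℕ} (m : ℕ) (hm : m ≤ n) : Omega n :=
  ⟨(m : ℤ), Finset.mem_Icc.2 ⟨by lia, by lia⟩⟩

/-- A bijection `π` of `Omega n` is a signed permutation of length `n` if
`π (-a) = -π a` for all `a`. -/
def IsSigned {n : ℕ} (π : Equiv.Perm (Omega n)) : Prop :=
  ∀ a : Omega n, π a.neg = (π a).neg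

noncomputable instance {n : ℕ} (π : Equiv.Perm (Omega n)) : Decidable (IsSigned π) :=
  inferInstanceAs (Decidable (∀ a : Omega n, π a.neg = (π a).neg))

/-- The hyperoctahedral group: the set of all signed permutations of length `n`. -/
noncomputable def signedPerms (n : ℕ) : Finset (Equiv.Perm (Omega n)) :=
  {π | IsSigned π}

/-- The descent set of `π` in the natural order: the indices `i ∈ {0, 1, …, n - 1}` with
`π i > π (i + 1)`. -/
noncomputable def descentSet {n : ℕ} (π : Equiv.Perm (Omega n)) : Finset (Fin n) :=
  {i | (π (Omega.ofNat ((i : ℕ) + 1) i.2) : ℤ) < (π (Omega.ofNat (i : ℕ) i.2.le) : ℤ)}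

/-- The number of descents of `π` in the natural order. -/
noncomputable def des {n : ℕ} (π : Equiv.Perm (Omega n)) : ℕ := (descentSet π).card

/-- The set of signed involutions of length `n`. -/
noncomputable def signedInvolutions (n : ℕ) : Finset (Equiv.Perm (Omega n)) :=
  {π ∈ signedPerms n | π⁻¹ = π}

/-- The number of signed involutions of length `n` with exactly `k` descents in the natural
order, for an arbitrary integer `k`. -/
noncomputable def numInvolutions (n : ℕ) (k : ℤ) : ℕ :=
  {π ∈ signedInvolutions n | (des π : ℤ) = k}.card

end SignedPerm

/-! Write `I_n(t)` for the descent polynomial of the signed involutions of length `n`. The proof is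
a P-partition argument: count in two ways the matrices of natural numbers indexed by `Omega r ×
Omega r`, with total `2n + 1`, that are invariant under transposition and under negating both
indices.

Reading a compatible pair `(π, f)` as the word of letters `(f a, f (π a))` and recording
multiplicities is a bijection onto these matrices (`ncard_compatiblePairs`). The word is
lexicographically sorted, hence determined by its multiplicities, and `π` is recovered as the
standardization of its second row. For fixed `π`, subtracting from `f` the number of preceding
descents leaves an arbitrary weakly increasing sequence, so there are `(r + 1 - des π).multichoose
n` labellings. Hence `∑_r numMatrices n r t^r = I_n(t) / (1 - t)^(n+1)` (`descentSeries_eq`).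

On the other hand the matrix entries are free on the orbits of the two symmetries. The central entry
is odd, the other entries on the two diagonals lie in orbits of size 2, and all remaining ones in
orbits of size 4, which gives `∑_n numMatrices n r x^n = 1 / ((1 - x)^(2r+1) (1 - x^2)^(r^2))`
(`mk_ncard_symmMatrices_mul`). Logarithmic differentiation in `x` yields a three-term recurrence in
`n` with coefficients polynomial in `r` (`numMatrices_add_two`). In the series over `r`,
multiplication by `r` is the operator `t d/dt`. Conjugating it by powers of `1 - t` turns the
recurrence into one for `I_n(t)` (`descentSeries_rec`), whose coefficients give the theorem. -/

namespace SignedPerm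

/-! ### Sorted words and standardization on a finite linear order -/

section FiniteLinearOrder

variable {α β : Type*} [LinearOrder α] [Fintype α] [LinearOrder β]

/-- A monotone map on a finite linear order is determined by its multiset of values. -/
theorem eq_of_monotone_of_map_univ_eq {f g : α → β} (hf : Monotone f) (hg : Monotone g)
    (h : (Finset.univ : Finset α).val.map f = (Finset.univ : Finset α).val.map g) : f = g := by
  set l : List α := (Finset.univ : Finset α).sort (· ≤ ·) with hl
  have hlu : (l : Multiset α) = (Finset.univ : Finset α).val := Finset.sort_eq _ _
  have hls : l.Pairwise (· ≤ ·) := Finset.pairwise_sort _ _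
  have hmono : ∀ {e : α → β}, Monotone e → (l.map e).Pairwise (· ≤ ·) := fun he =>
    List.pairwise_map.2 (hls.imp fun hab => he hab)
  rw [← hlu, Multiset.map_coe, Multiset.map_coe, Multiset.coe_eq_coe] at h
  have heq : l.map f = l.map g :=
    h.eq_of_pairwise (fun _ _ _ _ h₁ h₂ => le_antisymm h₁ h₂) (hmono hf) (hmono hg)
  funext a
  exact List.map_inj_left.1 heq a (by simp [hl])

/-- Every multiset of the right size is the multiset of values of a monotone map. -/
theorem exists_monotone_map_univ_eq (m : Multiset β) (hm : m.card = Fintype.card α) :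
    ∃ f : α → β, Monotone f ∧ (Finset.univ : Finset α).val.map f = m := by
  set l := m.sort (· ≤ ·) with hl
  have hlen : l.length = Fintype.card α := by rw [hl, Multiset.length_sort, hm]
  let e : Fin l.length ≃o α := monoEquivOfFin α hlen.symm
  refine ⟨fun a => l.get (e.symm a), fun a b hab => ?_, ?_⟩
  · exact (m.pairwise_sort (· ≤ ·)).sortedLE.monotone_get (e.symm.monotone hab)
  · have h1 : (Finset.univ : Finset α).val = (Finset.univ : Finset (Fin l.length)).val.map e := by
      rw [← Finset.map_univ_equiv e.toEquiv, Finset.map_val]; rfl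
    rw [h1, Multiset.map_map]
    simp only [Function.comp_def, OrderIso.symm_apply_apply]
    have h2 : (Finset.univ : Finset (Fin l.length)).val = (List.finRange l.length : Multiset _) := rfl
    rw [h2, Multiset.map_coe, List.map_get_finRange, hl, Multiset.sort_eq]

/-- A permutation of a finite linear order is determined by the order of its values. -/
theorem perm_eq_of_lt_iff {π σ : Equiv.Perm α} (h : ∀ a b, π a < π b ↔ σ a < σ b) : π = σ := by
  have hmono : Monotone fun a => π (σ.symm a) := by
    intro a b hab
    rw [← not_lt, h]
    simpa using hab
  have hmap : (Finset.univ : Finset α).val.map (fun a => π (σ.symm a)) =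
      (Finset.univ : Finset α).val.map id := by
    have := Finset.map_univ_equiv (σ.symm.trans π)
    rw [Multiset.map_id]
    exact congrArg Finset.val this
  have := eq_of_monotone_of_map_univ_eq hmono monotone_id hmap
  ext a
  simpa using congrFun this (σ a)

/-- The standardization of a word. -/
theorem exists_standardization (g : α → β) :
    ∃ π : Equiv.Perm α, ∀ a b, π a < π b ↔ toLex (g a, a) < toLex (g b, b) := by
  obtain ⟨f, hf, hfm⟩ := exists_monotone_map_univ_eq (α := α)
    ((Finset.univ : Finset α).val.map fun a => toLex (g a, a)) (by simp)
  have hinj : Function.Injective f := by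
    have hn : ((Finset.univ : Finset α).val.map f).Nodup := by
      rw [hfm]
      exact Multiset.Nodup.map (fun a b hab => (Prod.ext_iff.1 (toLex.injective hab)).2)
        Finset.univ.nodup
    intro a b hab
    exact Multiset.inj_on_of_nodup_map hn a (Finset.mem_univ _) b (Finset.mem_univ _) hab
  have hval : ∀ a, f a = toLex (g (ofLex (f a)).2, (ofLex (f a)).2) := by
    intro a
    have : f a ∈ (Finset.univ : Finset α).val.map f := Multiset.mem_map_of_mem _ (Finset.mem_univ a)
    rw [hfm, Multiset.mem_map] at this
    obtain ⟨c, -, hc⟩ := this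
    rw [← hc]; rfl
  have hτ : Function.Injective fun a => (ofLex (f a)).2 := by
    intro a b hab
    apply hinj
    rw [hval a, hval b]
    simp only at hab
    rw [hab]
  -- `f` lists the pairs `(g a, a)` in sorted order, so `τ a` is the position of the `a`-th smallest
  -- letter; the standardization is its inverse.
  let τ : Equiv.Perm α := Equiv.ofBijective _ (Finite.injective_iff_bijective.1 hτ)
  have hfτ : ∀ a, f a = toLex (g (τ a), τ a) := hval
  refine ⟨τ.symm, fun a b => ?_⟩
  rw [← (hf.strictMono_of_injective hinj).lt_iff_lt, hfτ, hfτ]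
  simp

end FiniteLinearOrder

/-! ### Words of pairs and their multiplicity matrices -/

section Content

variable {α β γ : Type*} [Fintype α] [DecidableEq γ]

/-- The number of times each value is taken. -/
def content (u : α → γ) (x : γ) : ℕ := (Finset.univ.filter fun a => u a = x).card

theorem content_eq_count (u : α → γ) (x : γ) :
    content u x = ((Finset.univ : Finset α).val.map u).count x := by
  rw [Multiset.count_map, content, Finset.card_def, Finset.filter_val]
  simp only [eq_comm]

theorem content_comp_equiv (u : α → γ) (σ : Equiv.Perm α) :
    content (fun a => u (σ a)) = content u := by
  funext x
  refine Finset.card_bij (fun a _ => σ a) (by simp) (by simp) fun b hb => ⟨σ.symm b, ?_, by simp⟩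
  simpa using hb

theorem content_comp_left (u : α → γ) {φ : γ → γ} (hφ : Function.Involutive φ) (x : γ) :
    content (fun a => φ (u a)) x = content u (φ x) := by
  unfold content
  congr 1
  ext a
  simp [hφ.eq_iff]

theorem sum_content [Fintype γ] (u : α → γ) : ∑ x, content u x = Fintype.card α := by
  simp only [content]
  rw [← Finset.card_eq_sum_card_fiberwise (f := u) (t := Finset.univ) (by simp)]
  rfl

variable [LinearOrder α] [LinearOrder β]

theorem eq_of_content_eq {u v : α → β × β} (hu : Monotone fun a => toLex (u a))
    (hv : Monotone fun a => toLex (v a)) (h : content u = content v) : u = v := by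
  have h1 : (Finset.univ : Finset α).val.map u = (Finset.univ : Finset α).val.map v := by
    ext x
    rw [← content_eq_count, ← content_eq_count, h]
  have h2 := eq_of_monotone_of_map_univ_eq hu hv (by
    have := congrArg (Multiset.map toLex) h1
    simpa only [Multiset.map_map, Function.comp_def] using this)
  funext a
  exact toLex.injective (congrFun h2 a)

theorem exists_content_eq [Fintype β] (A : β × β → ℕ) (hA : ∑ x, A x = Fintype.card α) :
    ∃ u : α → β × β, (Monotone fun a => toLex (u a)) ∧ content u = A := by
  obtain ⟨f, hf, hfm⟩ := exists_monotone_map_univ_eq (α := α)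
    ((∑ x, Multiset.replicate (A x) x).map toLex) (by simp [hA])
  refine ⟨fun a => ofLex (f a), hf, ?_⟩
  funext x
  have : (Finset.univ : Finset α).val.map (fun a => ofLex (f a)) =
      ∑ x, Multiset.replicate (A x) x := by
    have := congrArg (Multiset.map ofLex) hfm
    simpa [Multiset.map_map, Function.comp_def] using this
  rw [content_eq_count, this, Multiset.count_sum']
  simp [Multiset.count_replicate]

end Content

/-! ### Compatible pairs correspond to symmetric matrices -/

section Compatible

variable {α β : Type*} [LinearOrder α] [LinearOrder β]

theorem monotone_toLex_of {f g : α → β} (hf : Monotone f)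
    (h : ∀ a b, a < b → f a = f b → g a ≤ g b) : Monotone fun a => toLex (f a, g a) := by
  intro a b hab
  rcases hab.eq_or_lt with rfl | hlt
  · exact le_rfl
  rw [Prod.Lex.toLex_le_toLex]
  rcases (hf hab).eq_or_lt with heq | hl
  · exact Or.inr ⟨heq, h a b hlt heq⟩
  · exact Or.inl hl

/-- `f` is an odd weakly increasing labelling which is strict at the descents of `π`. -/
structure IsCompatible (ν : α → α) (μ : β → β) (π : Equiv.Perm α) (f : α → β) : Prop where
  monotone : Monotone f
  odd : ∀ a, f (ν a) = μ (f a)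
  lt_of_eq : ∀ a b, a < b → f a = f b → π a < π b

/-- Pairs of an odd involution and a compatible labelling. -/
def compatiblePairs (ν : α → α) (μ : β → β) : Set (Equiv.Perm α × (α → β)) :=
  {p | (∀ a, p.1 (p.1 a) = a) ∧ (∀ a, p.1 (ν a) = ν (p.1 a)) ∧ IsCompatible ν μ p.1 p.2}

/-- Matrices with total `N` that are invariant under transposition and under `μ`. -/
def symmMatrices [Fintype β] (μ : β → β) (N : ℕ) : Set (β × β → ℕ) :=
  {A | (∀ x, A x.swap = A x) ∧ (∀ x, A (μ x.1, μ x.2) = A x) ∧ ∑ x, A x = N}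

theorem IsCompatible.monotone_pair {ν : α → α} {μ : β → β} {π : Equiv.Perm α} {f : α → β}
    (h : IsCompatible ν μ π f) : Monotone fun a => toLex (f a, f (π a)) :=
  monotone_toLex_of h.monotone fun a b hab heq => h.monotone (h.lt_of_eq a b hab heq).le

/-- For an involution, compatibility says exactly how ties in `f ∘ π` are broken: by position. Thus
`π` is the standardization of `f ∘ π`, which is what makes it recoverable from the word. -/
theorem IsCompatible.lt_iff {ν : α → α} {μ : β → β} {π : Equiv.Perm α} {f : α → β}
    (h : IsCompatible ν μ π f) (hπ : ∀ a, π (π a) = a) (a b : α) :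
    π a < π b ↔ toLex (f (π a), a) < toLex (f (π b), b) := by
  have key : ∀ a b, π a < π b → toLex (f (π a), a) < toLex (f (π b), b) := by
    intro a b hab
    rw [Prod.Lex.toLex_lt_toLex]
    rcases (h.monotone hab.le).eq_or_lt with heq | hl
    · have := h.lt_of_eq _ _ hab heq
      rw [hπ, hπ] at this
      exact Or.inr ⟨heq, this⟩
    · exact Or.inl hl
  refine ⟨key a b, fun hab => ?_⟩
  rcases lt_trichotomy (π a) (π b) with hl | heq | hl
  · exact hl
  · rw [π.injective heq] at hab
    exact absurd hab (lt_irrefl _)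
  · exact absurd hab (key b a hl).not_gt

variable [Fintype α] {ν : α → α} {μ : β → β}

theorem injOn_content_compatiblePairs :
    Set.InjOn (fun p : Equiv.Perm α × (α → β) => content fun a => (p.2 a, p.2 (p.1 a)))
      (compatiblePairs ν μ) := by
  rintro ⟨π, f⟩ ⟨hπ, -, hf⟩ ⟨σ, g⟩ ⟨hσ, -, hg⟩ heq
  have h := eq_of_content_eq hf.monotone_pair hg.monotone_pair heq
  have hfg : f = g := by
    funext a
    exact congrArg Prod.fst (congrFun h a)
  subst hfg
  have h2 : ∀ a, f (π a) = f (σ a) := fun a => congrArg Prod.snd (congrFun h a)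
  have : π = σ := perm_eq_of_lt_iff fun a b => by
    rw [hf.lt_iff hπ, hg.lt_iff hσ]
    simp only [h2]
  rw [this]

variable [Fintype β]

/-- Reindexing the word by `π` swaps the two rows, and reindexing by `ν` applies `μ` to both;
neither changes multiplicities. -/
theorem mapsTo_content_compatiblePairs (hν : Function.Involutive ν) (hμ : Function.Involutive μ) :
    Set.MapsTo (fun p : Equiv.Perm α × (α → β) => content fun a => (p.2 a, p.2 (p.1 a)))
      (compatiblePairs ν μ) (symmMatrices μ (Fintype.card α)) := by
  rintro ⟨π, f⟩ ⟨hπ, hodd, hf⟩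
  refine ⟨fun x => ?_, fun x => ?_, sum_content _⟩
  · simp only
    rw [← content_comp_left _ (φ := Prod.swap) Prod.swap_swap x,
      ← content_comp_equiv (fun a => (f a, f (π a))) π]
    simp [hπ]
  · have hφ : Function.Involutive fun x : β × β => (μ x.1, μ x.2) := fun x => by simp [hμ _]
    have := content_comp_left (fun a => (f a, f (π a))) hφ x
    simp only at this ⊢
    rw [← this, ← content_comp_equiv (fun a => (f a, f (π a))) hν.toPerm]
    have hfo : ∀ a, f (ν a) = μ (f a) := hf.odd
    simp only at hodd
    simp [hodd, hfo]

/-- Sort the letters prescribed by the matrix into a word `u`; take its first row as `f` and the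
standardization of its second row as `π`. Each symmetry of the matrix produces another sorted word
with the same content, which must therefore equal `u`. -/
theorem surjOn_content_compatiblePairs (hν : Function.Involutive ν) (hμ : Function.Involutive μ)
    (hνa : Antitone ν) (hμa : Antitone μ) :
    Set.SurjOn (fun p : Equiv.Perm α × (α → β) => content fun a => (p.2 a, p.2 (p.1 a)))
      (compatiblePairs ν μ) (symmMatrices μ (Fintype.card α)) := by
  rintro A ⟨hA1, hA2, hA3⟩
  obtain ⟨u, hu, huA⟩ := exists_content_eq (α := α) A hA3
  have hμs : StrictAnti μ := hμa.strictAnti_of_injective hμ.injective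
  have hνs : StrictAnti ν := hνa.strictAnti_of_injective hν.injective
  have hodd : ∀ a, u (ν a) = (μ (u a).1, μ (u a).2) := by
    have hφ : Function.Involutive fun x : β × β => (μ x.1, μ x.2) := fun x => by simp [hμ _]
    -- Reversing positions by `ν` and letters by `μ` restores the lexicographic order.
    have h1 : (fun a => (μ (u (ν a)).1, μ (u (ν a)).2)) = u := by
      refine eq_of_content_eq (fun a b hab => ?_) hu ?_
      · have h := hu (hνa hab)
        rw [Prod.Lex.toLex_le_toLex'] at h ⊢
        refine ⟨hμa h.1, fun he => hμa (h.2 (hμ.injective he.symm))⟩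
      · funext x
        have := content_comp_left (fun a => u (ν a)) hφ x
        rw [this, show content (fun a => u (ν a)) = content u from
          content_comp_equiv u hν.toPerm, huA, hA2]
    intro a
    have := congrFun h1 (ν a)
    simp only [hν a] at this
    exact this.symm
  obtain ⟨π, hπ⟩ := exists_standardization fun a => (u a).2
  -- Rearranging by `π.symm` sorts by the second row, with ties in the original order and so with
  -- the first row increasing: the swapped word is sorted too.
  have hsw : (fun a => (u (π.symm a)).swap) = u := by
    refine eq_of_content_eq ?_ hu ?_
    · have hm : ∀ a b, a < b → (u (π.symm a)).2 < (u (π.symm b)).2 ∨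
          (u (π.symm a)).2 = (u (π.symm b)).2 ∧ π.symm a < π.symm b := by
        intro a b hab
        have := (hπ (π.symm a) (π.symm b)).1 (by simpa using hab)
        rwa [Prod.Lex.toLex_lt_toLex] at this
      refine monotone_toLex_of (f := fun a => (u (π.symm a)).2) (g := fun a => (u (π.symm a)).1)
        (fun a b hab => ?_) fun a b hab he => ?_
      · rcases hab.eq_or_lt with rfl | hlt
        · exact le_rfl
        · rcases hm a b hlt with h | h
          exacts [h.le, h.1.le]
      · rcases hm a b hab with h | h
        · exact absurd he h.ne
        · have := hu h.2.le
          simp only [Prod.Lex.toLex_le_toLex'] at this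
          exact this.1
    · funext x
      rw [content_comp_left (fun a => u (π.symm a)) Prod.swap_swap, content_comp_equiv u π.symm,
        huA, hA1]
  have h1 : ∀ a, (u (π.symm a)).2 = (u a).1 := fun a => congrArg Prod.fst (congrFun hsw a)
  have h2 : ∀ a, (u (π.symm a)).1 = (u a).2 := fun a => congrArg Prod.snd (congrFun hsw a)
  have h3 : ∀ a, (u (π a)).1 = (u a).2 := fun a => by rw [← h1]; simp
  have hfm : Monotone fun a => (u a).1 := fun a b hab => by
    have := hu hab
    simp only [Prod.Lex.toLex_le_toLex'] at this
    exact this.1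
  have hsymm : π.symm = π := by
    refine perm_eq_of_lt_iff fun a b => ?_
    rw [hπ]
    have key : ∀ a b, toLex ((u a).2, a) < toLex ((u b).2, b) → π.symm a < π.symm b := by
      intro a b hab
      rw [Prod.Lex.toLex_lt_toLex] at hab
      rcases hab with h | ⟨he, h⟩
      · simp only [← h2] at h
        exact lt_of_not_ge fun hle => absurd (hfm hle) h.not_ge
      · simp only [← h2] at he
        have := (hπ (π.symm a) (π.symm b)).1 (by simpa using h)
        rw [Prod.Lex.toLex_lt_toLex] at this
        rcases this with h' | h'
        · refine lt_of_not_ge fun hle => ?_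
          have := hu hle
          simp only [Prod.Lex.toLex_le_toLex'] at this
          exact absurd (this.2 he.symm) h'.not_ge
        · exact h'.2
    refine ⟨fun hab => ?_, key a b⟩
    rcases lt_trichotomy (toLex ((u a).2, a)) (toLex ((u b).2, b)) with hl | he | hl
    · exact hl
    · rw [show a = b from (Prod.ext_iff.1 (toLex.injective he)).2] at hab
      exact absurd hab (lt_irrefl _)
    · exact absurd hab (key b a hl).not_gt
  have hinv : ∀ a, π (π a) = a := fun a => by
    rw [← Equiv.eq_symm_apply, hsymm]
  refine ⟨(π, fun a => (u a).1), ⟨hinv, fun a => ?_, hfm, fun a => ?_, fun a b hab he => ?_⟩, ?_⟩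
  -- Conjugation by `ν` reverses both letters and positions, hence preserves the comparison that
  -- determines the standardization.
  · have : π = hν.toPerm.trans (π.trans hν.toPerm) := perm_eq_of_lt_iff fun a b => by
      simp only [Equiv.trans_apply, Function.Involutive.coe_toPerm, hνs.lt_iff_gt]
      rw [hπ, hπ]
      simp only [Prod.Lex.toLex_lt_toLex, hodd, hμs.lt_iff_gt, hνs.lt_iff_gt, hμ.injective.eq_iff]
      simp only [eq_comm]
    have h := congrArg (fun σ : Equiv.Perm α => σ (ν a)) this
    simpa [hν a] using h
  · simp [hodd]
  · rw [hπ, Prod.Lex.toLex_lt_toLex']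
    have := hu hab.le
    simp only [Prod.Lex.toLex_le_toLex'] at this
    exact ⟨this.2 he, fun _ => hab⟩
  · simp only [h3]
    exact huA

theorem ncard_compatiblePairs (hν : Function.Involutive ν) (hμ : Function.Involutive μ)
    (hνa : Antitone ν) (hμa : Antitone μ) :
    (compatiblePairs ν μ : Set (Equiv.Perm α × (α → β))).ncard =
      (symmMatrices μ (Fintype.card α)).ncard := by
  have h : Set.BijOn _ _ _ := ⟨mapsTo_content_compatiblePairs (α := α) (β := β) hν hμ,
    injOn_content_compatiblePairs, surjOn_content_compatiblePairs hν hμ hνa hμa⟩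
  rw [← h.image_eq, h.injOn.ncard_image]

end Compatible

/-! ### Generating function of weighted sums -/

section Weighted

open PowerSeries

theorem ncard_weighted_sum_eq_coeff {ι : Type*} [Fintype ι] [DecidableEq ι] (w : ι → ℕ)
    (hw : ∀ i, 0 < w i) (n : ℕ) :
    (({B : ι → ℕ | ∑ i, w i * B i = n}.ncard : ℕ) : ℤ) =
      coeff n (∏ i, (mk fun m => if w i ∣ m then (1 : ℤ) else 0)) := by
  rw [coeff_prod]
  simp only [coeff_mk, Finset.prod_ite_zero, Finset.prod_const_one]
  rw [Finset.sum_boole, Nat.cast_inj, ← Set.ncard_coe_finset]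
  refine Set.ncard_congr (fun B _ => Finsupp.equivFunOnFinite.symm fun i => w i * B i) ?_ ?_ ?_
  · intro B hB
    simpa using hB
  · intro B C _ _ h
    funext i
    have := DFunLike.congr_fun h i
    simpa [(hw i).ne'] using this
  · intro l hl
    simp only [Finset.coe_filter, Finset.mem_finsuppAntidiag, Set.mem_ofPred_eq] at hl
    refine ⟨fun i => l i / w i, ?_, ?_⟩
    · simp only [Set.mem_ofPred_eq]
      rw [← hl.1.1]
      exact Finset.sum_congr rfl fun i _ => Nat.mul_div_cancel' (hl.2 i (Finset.mem_univ i))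
    · ext i
      simpa using Nat.mul_div_cancel' (hl.2 i (Finset.mem_univ i))

theorem one_sub_X_pow_mul_mk_dvd (w : ℕ) (hw : 0 < w) :
    (1 - X ^ w : ℤ⟦X⟧) * (mk fun m => if w ∣ m then (1 : ℤ) else 0) = 1 := by
  ext m
  rw [sub_mul, one_mul, map_sub, coeff_X_pow_mul', coeff_mk, coeff_one]
  by_cases h : w ≤ m
  · have : w ∣ m - w ↔ w ∣ m := Nat.dvd_sub_iff_left h dvd_rfl
    have hm : m ≠ 0 := by omega
    simp [h, this, hm]
  · rcases Nat.eq_zero_or_pos m with rfl | hm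
    · simp [hw.ne']
    · have : ¬ w ∣ m := fun hd => h (Nat.le_of_dvd hm hd)
      simp [h, this, hm.ne']

end Weighted

/-! ### Orbits of matrix cells and the generating function of invariant matrices -/

section Matrices

variable {r : ℕ}

theorem Omega.neg_involutive : Function.Involutive (Omega.neg (n := r)) := fun a =>
  Subtype.ext (neg_neg a.1)

theorem Omega.neg_antitone : Antitone (Omega.neg (n := r)) := fun _ _ h =>
  Subtype.coe_le_coe.1 (neg_le_neg (Subtype.coe_le_coe.2 h))

theorem Omega.card (r : ℕ) : Fintype.card (Omega r) = 2 * r + 1 := by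
  rw [Fintype.card_coe, Int.card_Icc]
  omega

/-- Representatives of the orbits of transposition and negation on `Omega r × Omega r`. -/
abbrev Cell (r : ℕ) : Type :=
  {p : Omega r × Omega r // -(p.1 : ℤ) ≤ p.2 ∧ (p.2 : ℤ) ≤ p.1}

/-- The size of an orbit, up to a factor `2`. -/
def Cell.weight (d : Cell r) : ℕ :=
  if (d.1.2 : ℤ) = d.1.1 ∨ (d.1.2 : ℤ) = -(d.1.1 : ℤ) then 1 else 2

/-- The central cell. -/
def Cell.IsZero (d : Cell r) : Prop := (d.1.1 : ℤ) = 0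

instance (d : Cell r) : Decidable d.IsZero := inferInstanceAs (Decidable ((d.1.1 : ℤ) = 0))

/-- The representative of the orbit of `p`. -/
def Cell.of (p : Omega r × Omega r) : Cell r :=
  if h : -(p.1 : ℤ) ≤ p.2 ∧ (p.2 : ℤ) ≤ p.1 then ⟨p, h⟩
  else if h' : (p.1 : ℤ) ≤ p.2 ∧ (p.2 : ℤ) ≤ -p.1 then
    ⟨(p.1.neg, p.2.neg), by simp only [Omega.neg]; omega⟩
  else if h'' : 0 ≤ (p.2 : ℤ) then ⟨(p.2, p.1), by simp only; omega⟩
  else ⟨(p.2.neg, p.1.neg), by simp only [Omega.neg]; omega⟩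

theorem Cell.of_eq_iff (p : Omega r × Omega r) (d : Cell r) :
    Cell.of p = d ↔ p = d.1 ∨ p = (d.1.1.neg, d.1.2.neg) ∨ p = (d.1.2, d.1.1) ∨
      p = (d.1.2.neg, d.1.1.neg) := by
  obtain ⟨⟨⟨x, hx⟩, ⟨y, hy⟩⟩, hd⟩ := d
  obtain ⟨⟨a, ha⟩, ⟨b, hb⟩⟩ := p
  simp only [Cell.of]
  simp only at hd
  split_ifs <;> simp only [Omega.neg, Subtype.mk.injEq, Prod.mk.injEq] <;> omega

theorem Cell.of_coe (d : Cell r) : Cell.of d.1 = d := (Cell.of_eq_iff _ _).2 (Or.inl rfl)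

theorem Cell.of_swap (p : Omega r × Omega r) : Cell.of p.swap = Cell.of p := by
  have h := (Cell.of_eq_iff p _).1 rfl
  rw [Cell.of_eq_iff]
  generalize Cell.of p = d at h
  obtain ⟨⟨⟨x, hx⟩, ⟨y, hy⟩⟩, hd⟩ := d
  obtain ⟨⟨a, ha⟩, ⟨b, hb⟩⟩ := p
  simp only [Prod.swap, Omega.neg, Subtype.mk.injEq, Prod.mk.injEq] at h ⊢
  omega

theorem Cell.of_neg (p : Omega r × Omega r) : Cell.of (p.1.neg, p.2.neg) = Cell.of p := by
  have h := (Cell.of_eq_iff p _).1 rfl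
  rw [Cell.of_eq_iff]
  generalize Cell.of p = d at h
  obtain ⟨⟨⟨x, hx⟩, ⟨y, hy⟩⟩, hd⟩ := d
  obtain ⟨⟨a, ha⟩, ⟨b, hb⟩⟩ := p
  simp only [Omega.neg, Subtype.mk.injEq, Prod.mk.injEq] at h ⊢
  omega

theorem Cell.weight_eq (d : Cell r) : d.weight = 1 ∨ d.weight = 2 := by
  unfold Cell.weight
  split_ifs <;> simp

theorem Cell.weight_eq_one_iff (d : Cell r) :
    d.weight = 1 ↔ (d.1.2 : ℤ) = d.1.1 ∨ (d.1.2 : ℤ) = -(d.1.1 : ℤ) := by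
  unfold Cell.weight
  split_ifs <;> omega

theorem Cell.weight_eq_two_iff (d : Cell r) :
    d.weight = 2 ↔ ¬((d.1.2 : ℤ) = d.1.1 ∨ (d.1.2 : ℤ) = -(d.1.1 : ℤ)) := by
  unfold Cell.weight
  split_ifs <;> omega

theorem Cell.card_fiber (d : Cell r) :
    (Finset.univ.filter fun p => Cell.of p = d).card = if d.IsZero then 1 else 2 * d.weight := by
  have h4 : (Finset.univ.filter fun p => Cell.of p = d) =
      {d.1, (d.1.1.neg, d.1.2.neg), (d.1.2, d.1.1), (d.1.2.neg, d.1.1.neg)} := by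
    ext p
    simp [Cell.of_eq_iff]
  rw [h4]
  obtain ⟨⟨⟨x, hx⟩, ⟨y, hy⟩⟩, hd⟩ := d
  simp only at hd
  split_ifs with h0
  · simp only [Cell.IsZero] at h0
    rw [Finset.card_eq_one]
    refine ⟨(⟨x, hx⟩, ⟨y, hy⟩), ?_⟩
    ext ⟨⟨a, ha⟩, ⟨b, hb⟩⟩
    simp only [Finset.mem_singleton, Finset.mem_insert, Subtype.mk.injEq, Prod.mk.injEq, Omega.neg]
    omega
  · simp only [Cell.IsZero] at h0
    rcases Cell.weight_eq ⟨(⟨x, hx⟩, ⟨y, hy⟩), hd⟩ with h1 | h1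
    · rw [h1, mul_one]
      simp only [Cell.weight_eq_one_iff] at h1
      rw [Finset.card_eq_two]
      refine ⟨(⟨x, hx⟩, ⟨y, hy⟩), (Omega.neg ⟨x, hx⟩, Omega.neg ⟨y, hy⟩), ?_, ?_⟩
      · simp only [Omega.neg, ne_eq, Subtype.mk.injEq, Prod.mk.injEq]
        omega
      ext ⟨⟨a, ha⟩, ⟨b, hb⟩⟩
      simp only [Finset.mem_singleton, Finset.mem_insert, Subtype.mk.injEq, Prod.mk.injEq,
        Omega.neg]
      omega
    · rw [h1]
      simp only [Cell.weight_eq_two_iff] at h1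
      repeat rw [Finset.card_insert_of_notMem (by
        simp only [Finset.mem_insert, Finset.mem_singleton, Subtype.mk.injEq, Prod.mk.injEq,
          Omega.neg]
        omega)]
      rfl

/-- The central cell. -/
def Cell.zero (r : ℕ) : Cell r :=
  ⟨(Omega.ofNat 0 r.zero_le, Omega.ofNat 0 r.zero_le), by simp [Omega.ofNat]⟩

theorem Cell.isZero_iff (d : Cell r) : d.IsZero ↔ d = Cell.zero r := by
  obtain ⟨⟨⟨x, hx⟩, ⟨y, hy⟩⟩, hd⟩ := d
  simp only [Cell.IsZero, Cell.zero, Omega.ofNat, Subtype.mk.injEq, Prod.mk.injEq]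
  simp only at hd
  omega

theorem Cell.sum_of (C : Cell r → ℕ) :
    ∑ p, C (Cell.of p) = ∑ d : Cell r, (if d.IsZero then 1 else 2 * d.weight) * C d := by
  rw [← Finset.sum_fiberwise Finset.univ Cell.of]
  refine Finset.sum_congr rfl fun d _ => ?_
  rw [← Cell.card_fiber, Finset.card_eq_sum_ones, Finset.sum_mul]
  refine Finset.sum_congr rfl fun p hp => ?_
  rw [(Finset.mem_filter.1 hp).2, one_mul]

/-- The symmetric matrix with given entries on the cells; the central entry is made odd. -/
def matrixOf (B : Cell r → ℕ) (p : Omega r × Omega r) : ℕ :=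
  if (Cell.of p).IsZero then 2 * B (Cell.of p) + 1 else B (Cell.of p)

theorem Cell.weight_zero : (Cell.zero r).weight = 1 := by
  simp [Cell.weight, Cell.zero]

theorem sum_matrixOf (B : Cell r → ℕ) :
    ∑ p, matrixOf B p = 2 * (∑ d : Cell r, d.weight * B d) + 1 := by
  rw [show ∑ p, matrixOf B p = _ from
    Cell.sum_of fun d => if d.IsZero then 2 * B d + 1 else B d, Finset.mul_sum]
  have : ∀ d : Cell r, (if d.IsZero then 1 else 2 * d.weight) *
      (if d.IsZero then 2 * B d + 1 else B d) =
      2 * (d.weight * B d) + if d = Cell.zero r then 1 else 0 := by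
    intro d
    simp only [Cell.isZero_iff]
    split_ifs with h
    · subst h
      simp [Cell.weight_zero]
    · ring
  simp only [this, Finset.sum_add_distrib]
  simp

/-- An invariant matrix is a free choice of entries on the cells, except that the odd total forces
an odd central entry. Writing that entry as `2 * B + 1` lets the centre behave as one more cell of
weight 1. -/
theorem bijOn_matrixOf (r n : ℕ) :
    Set.BijOn matrixOf {B : Cell r → ℕ | ∑ d : Cell r, d.weight * B d = n}
      (symmMatrices Omega.neg (2 * n + 1)) := by
  refine ⟨fun B hB => ⟨fun p => ?_, fun p => ?_, ?_⟩, fun B _ C _ h => ?_, fun A hA => ?_⟩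
  · simp only [matrixOf, Cell.of_swap]
  · simp only [matrixOf, Cell.of_neg]
  · rw [sum_matrixOf, hB]
  · funext d
    have := congrFun h d.1
    simp only [matrixOf, Cell.of_coe] at this
    split_ifs at this <;> omega
  · obtain ⟨hA1, hA2, hA3⟩ := hA
    have hAof : ∀ p, A (Cell.of p).1 = A p := by
      intro p
      have h := (Cell.of_eq_iff p _).1 rfl
      generalize Cell.of p = d at h
      rcases h with h | h | h | h <;> rw [h]
      · rw [← hA2]
      · rw [← hA1]; rfl
      · rw [← hA2, ← hA1]; rfl
    -- Every orbit other than the centre has even size, while the total is `2 * n + 1`.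
    have hodd : A (Cell.zero r).1 % 2 = 1 := by
      have h := Cell.sum_of fun d : Cell r => A d.1
      simp only [hAof, hA3] at h
      rw [← Finset.add_sum_erase _ _ (Finset.mem_univ (Cell.zero r))] at h
      have h2 : 2 ∣ ∑ d ∈ Finset.univ.erase (Cell.zero r),
          (if d.IsZero then 1 else 2 * d.weight) * A d.1 := by
        refine Finset.dvd_sum fun d hd => ?_
        rw [if_neg (by rw [Cell.isZero_iff]; exact Finset.ne_of_mem_erase hd), mul_assoc]
        exact dvd_mul_right _ _
      rw [if_pos ((Cell.isZero_iff _).2 rfl)] at h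
      omega
    have hB : matrixOf (fun d => if d.IsZero then A d.1 / 2 else A d.1) = A := by
      funext p
      simp only [matrixOf]
      split_ifs with h
      · rw [← hAof p]
        rw [Cell.isZero_iff] at h
        rw [h]
        omega
      · exact hAof p
    refine ⟨_, ?_, hB⟩
    have := sum_matrixOf fun d : Cell r => if d.IsZero then A d.1 / 2 else A d.1
    rw [hB, hA3] at this
    simp only [Set.mem_ofPred_eq]
    omega

/-- These cells `(|y|, y)` form the boundary of the wedge, one for each second coordinate `y`. -/
theorem Cell.card_weight_one (r : ℕ) :
    (Finset.univ.filter fun d : Cell r => d.weight = 1).card = 2 * r + 1 := by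
  rw [← Omega.card r, ← Finset.card_univ]
  refine Finset.card_bij (fun d _ => d.1.2) (by simp) ?_ ?_
  · rintro ⟨⟨⟨x, hx⟩, ⟨y, hy⟩⟩, hd⟩ h1 ⟨⟨⟨x', hx'⟩, ⟨y', hy'⟩⟩, hd'⟩ h2 h
    simp only [Finset.mem_filter, Finset.mem_univ, true_and, Cell.weight_eq_one_iff,
      Subtype.mk.injEq, Prod.mk.injEq] at hd hd' h1 h2 h ⊢
    omega
  · rintro ⟨y, hy⟩ -
    have hy' := Finset.mem_Icc.1 hy
    refine ⟨⟨(⟨|y|, Finset.mem_Icc.2 ⟨?_, ?_⟩⟩, ⟨y, hy⟩), ?_, ?_⟩, ?_, rfl⟩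
    · linarith [abs_nonneg y]
    · exact abs_le.2 hy'
    · exact neg_abs_le y
    · exact le_abs_self y
    · simp only [Finset.mem_filter, Finset.mem_univ, true_and, Cell.weight_eq_one_iff]
      rcases abs_choice y with h | h <;> rw [h] <;> simp

theorem Cell.card_weight_two (r : ℕ) :
    (Finset.univ.filter fun d : Cell r => d.weight = 2).card = r ^ 2 := by
  have h1 : (Finset.univ.filter fun d : Cell r => d.weight = 2).card =
      ((Finset.range r).sigma fun i => Finset.Icc (-(i : ℤ)) i).card := by
    -- An interior cell satisfies `-x < y < x`, so `x ≥ 1`; with `i = x - 1` this reads `-i ≤ y ≤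
    -- i`, giving `2 * i + 1` cells.
    refine Finset.card_bij (fun d _ => ⟨(d.1.1 : ℤ).toNat - 1, d.1.2⟩) ?_ ?_ ?_
    · rintro ⟨⟨⟨x, hx⟩, ⟨y, hy⟩⟩, hd⟩ h1
      have hx' := Finset.mem_Icc.1 hx
      simp only [Finset.mem_filter, Finset.mem_univ, true_and, Cell.weight_eq_two_iff,
        Finset.mem_sigma, Finset.mem_range, Finset.mem_Icc] at hd h1 ⊢
      omega
    · rintro ⟨⟨⟨x, hx⟩, ⟨y, hy⟩⟩, hd⟩ h1 ⟨⟨⟨x', hx'⟩, ⟨y', hy'⟩⟩, hd'⟩ h2 h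
      simp only [Finset.mem_filter, Finset.mem_univ, true_and, Cell.weight_eq_two_iff,
        Subtype.mk.injEq, Prod.mk.injEq, Sigma.mk.injEq, heq_eq_eq] at hd hd' h1 h2 h ⊢
      omega
    · rintro ⟨i, y⟩ h
      simp only [Finset.mem_sigma, Finset.mem_range, Finset.mem_Icc] at h
      refine ⟨⟨(⟨(i : ℤ) + 1, Finset.mem_Icc.2 ?_⟩, ⟨y, Finset.mem_Icc.2 ?_⟩), ?_⟩, ?_, ?_⟩
      · omega
      · omega
      · simp only; omega
      · simp only [Finset.mem_filter, Finset.mem_univ, true_and, Cell.weight_eq_two_iff]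
        omega
      · simp only [Sigma.mk.injEq, heq_eq_eq, and_true]; omega
  rw [h1, Finset.card_sigma]
  simp only [Int.card_Icc]
  clear h1
  induction r with
  | zero => rfl
  | succ r ih =>
    rw [Finset.sum_range_succ, ih]
    have : ((r : ℤ) + 1 - -(r : ℤ)).toNat = 2 * r + 1 := by omega
    rw [this]
    ring

open PowerSeries in
/-- The generating function of invariant matrices, multiplied by its denominator. -/
theorem mk_ncard_symmMatrices_mul (r : ℕ) :
    (mk fun n => ((symmMatrices (Omega.neg (n := r)) (2 * n + 1)).ncard : ℤ)) *
      ((1 - X) ^ (2 * r + 1) * (1 - X ^ 2) ^ (r ^ 2)) = 1 := by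
  have hw : ∀ d : Cell r, 0 < d.weight := fun d => by rcases d.weight_eq with h | h <;> simp [h]
  have h1 : (mk fun n => ((symmMatrices (Omega.neg (n := r)) (2 * n + 1)).ncard : ℤ)) =
      ∏ d : Cell r, (mk fun m => if d.weight ∣ m then (1 : ℤ) else 0) := by
    ext n
    rw [coeff_mk, ← ncard_weighted_sum_eq_coeff _ hw, ← (bijOn_matrixOf r n).image_eq,
      (bijOn_matrixOf r n).injOn.ncard_image]
  have h2 : (1 - X : ℤ⟦X⟧) ^ (2 * r + 1) * (1 - X ^ 2) ^ (r ^ 2) =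
      ∏ d : Cell r, (1 - X ^ d.weight) := by
    rw [← Cell.card_weight_one, ← Cell.card_weight_two,
      ← Finset.prod_filter_mul_prod_filter_not Finset.univ fun d : Cell r => d.weight = 1]
    congr 1
    · rw [← Finset.prod_const]
      exact Finset.prod_congr rfl fun d hd => by rw [(Finset.mem_filter.1 hd).2, pow_one]
    · rw [← Finset.prod_const]
      refine Finset.prod_congr (Finset.filter_congr fun d _ => ?_) fun d hd => ?_
      · rcases d.weight_eq with h | h <;> simp [h]
      · rw [(d.weight_eq).resolve_left (Finset.mem_filter.1 hd).2]
  rw [h1, h2, ← Finset.prod_mul_distrib]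
  exact Finset.prod_eq_one fun d _ => by rw [mul_comm, one_sub_X_pow_mul_mk_dvd _ (hw d)]

end Matrices

/-! ### Counting the labellings compatible with a signed permutation -/

theorem card_monotone_fin (n m : ℕ) :
    {g : Fin n → Fin m | Monotone g}.ncard = m.multichoose n := by
  have h : Set.BijOn (fun g : Fin n → Fin m => (Finset.univ : Finset (Fin n)).val.map g)
      {g | Monotone g} {M | M.card = n} := by
    refine ⟨fun g _ => by simp, fun f hf g hg h => eq_of_monotone_of_map_univ_eq hf hg h,
      fun M hM => ?_⟩
    obtain ⟨f, hf, hfM⟩ := exists_monotone_map_univ_eq (α := Fin n) M (by simpa using hM)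
    exact ⟨f, hf, hfM⟩
  rw [← h.injOn.ncard_image, h.image_eq]
  have := Sym.card_sym_eq_multichoose (Fin m) n
  rw [Fintype.card_fin] at this
  rw [← this, ← Nat.card_eq_fintype_card]
  rfl

section Labellings

variable {n r : ℕ}

theorem Omega.ofNat_coe (m : ℕ) (hm : m ≤ n) : (Omega.ofNat m hm : ℤ) = m := rfl

theorem Omega.neg_coe (a : Omega n) : (a.neg : ℤ) = -a := rfl

theorem Omega.exists_ofNat (a : Omega n) (ha : 0 ≤ (a : ℤ)) :
    ∃ (m : ℕ) (hm : m ≤ n), a = Omega.ofNat m hm := by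
  have h := Finset.mem_Icc.1 a.2
  refine ⟨(a : ℤ).toNat, by omega, Subtype.ext ?_⟩
  rw [Omega.ofNat_coe]
  omega

theorem Omega.strictMono_of_lt_succ {γ : Type*} [Preorder γ] {h : Omega n → γ}
    (hs : ∀ a b : Omega n, (b : ℤ) = a + 1 → h a < h b) : StrictMono h := by
  have key : ∀ (m : ℕ) (a b : Omega n), (b : ℤ) = a + m + 1 → h a < h b := by
    intro m
    induction m with
    | zero => exact fun a b hab => hs a b (by simpa using hab)
    | succ m ih =>
      intro a b hab
      have ha := Finset.mem_Icc.1 a.2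
      have hb := Finset.mem_Icc.1 b.2
      let c : Omega n := ⟨a + m + 1, Finset.mem_Icc.2 ⟨by omega, by omega⟩⟩
      exact (ih a c rfl).trans (hs c b (by simp only [c]; omega))
  intro a b hab
  have hab' : (a : ℤ) < b := hab
  exact key ((b : ℤ) - a - 1).toNat a b (by omega)

/-- Oddness transfers conditions from the nonnegative half to the negative half, so compatibility
only needs checking on the consecutive pairs `i, i + 1` with `0 ≤ i < n`, the very pairs on which
descents are defined. -/
theorem isCompatible_iff {π : Equiv.Perm (Omega n)} (hπ : IsSigned π) (f : Omega n → Omega r) :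
    IsCompatible Omega.neg Omega.neg π f ↔ (∀ a, f a.neg = (f a).neg) ∧
      ∀ i : Fin n, (f (Omega.ofNat i i.2.le) : ℤ) + (if i ∈ descentSet π then 1 else 0) ≤
        f (Omega.ofNat (i + 1) i.2) := by
  constructor
  · intro h
    refine ⟨h.odd, fun i => ?_⟩
    have hlt : Omega.ofNat (i : ℕ) i.2.le < Omega.ofNat ((i : ℕ) + 1) i.2 := by
      rw [← Subtype.coe_lt_coe, Omega.ofNat_coe, Omega.ofNat_coe]; omega
    have hle : (f (Omega.ofNat i i.2.le) : ℤ) ≤ f (Omega.ofNat (i + 1) i.2) := h.monotone hlt.le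
    split_ifs with hi
    · refine Int.add_one_le_iff.2 (lt_of_le_of_ne hle fun he => ?_)
      have h1 : (π (Omega.ofNat i i.2.le) : ℤ) < π (Omega.ofNat (i + 1) i.2) :=
        h.lt_of_eq _ _ hlt (Subtype.ext he)
      simp only [descentSet, Finset.mem_filter, Finset.mem_univ, true_and] at hi
      omega
    · simpa using hle
  · rintro ⟨hodd, h⟩
    have hstep : ∀ i : Fin n,
        (f (Omega.ofNat i i.2.le) : ℤ) < f (Omega.ofNat (i + 1) i.2) ∨
        (f (Omega.ofNat i i.2.le) : ℤ) = f (Omega.ofNat (i + 1) i.2) ∧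
        (π (Omega.ofNat i i.2.le) : ℤ) < π (Omega.ofNat (i + 1) i.2) := by
      intro i
      have hi := h i
      by_cases hd : i ∈ descentSet π
      · rw [if_pos hd] at hi
        exact Or.inl (by omega)
      · rw [if_neg hd] at hi
        simp only [descentSet, Finset.mem_filter, Finset.mem_univ, true_and] at hd
        have hne : (π (Omega.ofNat i i.2.le) : ℤ) ≠ π (Omega.ofNat (i + 1) i.2) := by
          intro he
          have := congrArg Subtype.val (π.injective (Subtype.ext he))
          simp only [Omega.ofNat_coe] at this
          omega
        omega
    -- Lexicographic strict monotonicity packages monotonicity of `f` and increase of `π` on its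
    -- level sets, and is testable on consecutive elements.
    have hsm : StrictMono fun a => toLex (f a, π a) := by
      refine Omega.strictMono_of_lt_succ fun a b hab => ?_
      rw [Prod.Lex.toLex_lt_toLex]
      simp only [← Subtype.coe_lt_coe, ← Subtype.coe_inj]
      have ha' := Finset.mem_Icc.1 a.2
      have hb' := Finset.mem_Icc.1 b.2
      rcases le_or_gt 0 (a : ℤ) with ha | ha
      · obtain ⟨m, hm, rfl⟩ := a.exists_ofNat ha
        have hmn : m < n := by rw [Omega.ofNat_coe] at hab; omega
        have hb : b = Omega.ofNat (m + 1) hmn := Subtype.ext (by rw [hab]; rfl)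
        subst hb
        exact hstep ⟨m, hmn⟩
      -- Here `a = -(m + 1)` and `b = -m`: negation turns the pair into step `m`.
      · obtain ⟨m, hm, hbm⟩ := b.neg.exists_ofNat (by rw [Omega.neg_coe]; omega)
        have hbm' := congrArg Subtype.val hbm
        rw [Omega.neg_coe, Omega.ofNat_coe] at hbm'
        have hmn : m < n := by omega
        have ham : a.neg = Omega.ofNat (m + 1) hmn := Subtype.ext (by
          rw [Omega.neg_coe, Omega.ofNat_coe]; push_cast; omega)
        have := hstep ⟨m, hmn⟩
        simp only [← hbm, ← ham, hodd, hπ _, Omega.neg_coe] at this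
        omega
    refine ⟨fun a b hab => ?_, hodd, fun a b hab he => ?_⟩
    · have := hsm.monotone hab
      simp only [Prod.Lex.toLex_le_toLex'] at this
      exact this.1
    · have := hsm hab
      simp only [Prod.Lex.toLex_lt_toLex'] at this
      exact this.2 he

/-- The number of elements of `D` below `i`. -/
def countBelow (D : Finset (Fin n)) (i : ℕ) : ℕ := (D.filter fun j : Fin n => (j : ℕ) < i).card

theorem countBelow_zero (D : Finset (Fin n)) : countBelow D 0 = 0 := by simp [countBelow]

theorem countBelow_le (D : Finset (Fin n)) (i : ℕ) : countBelow D i ≤ D.card :=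
  Finset.card_filter_le _ _

theorem countBelow_self (D : Finset (Fin n)) : countBelow D n = D.card := by
  simp [countBelow]

theorem countBelow_succ (D : Finset (Fin n)) (i : Fin n) :
    countBelow D (i + 1) = countBelow D i + if i ∈ D then 1 else 0 := by
  unfold countBelow
  have : (D.filter fun j : Fin n => (j : ℕ) < i + 1) =
      (D.filter fun j : Fin n => (j : ℕ) < i) ∪ D.filter fun j : Fin n => j = i := by
    rw [← Finset.filter_or]
    refine Finset.filter_congr fun j _ => ?_
    rw [Fin.ext_iff]; omega
  rw [this, Finset.card_union_of_disjoint, Finset.filter_eq']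
  · split_ifs <;> simp
  · rw [Finset.disjoint_filter]
    rintro j - hj rfl
    exact lt_irrefl _ hj

/-- The values `g 0, …, g (n - 1)`, shifted by the number of preceding elements of `D`. -/
def shiftedValue {m : ℕ} (D : Finset (Fin n)) (g : Fin n → Fin m) (i : ℕ) : ℕ :=
  if h : 0 < i ∧ i ≤ n then (g ⟨i - 1, by omega⟩ : ℕ) + countBelow D i else 0

theorem shiftedValue_zero {m : ℕ} (D : Finset (Fin n)) (g : Fin n → Fin m) :
    shiftedValue D g 0 = 0 := by simp [shiftedValue]

theorem shiftedValue_succ {m : ℕ} (D : Finset (Fin n)) (g : Fin n → Fin m) (i : Fin n) :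
    shiftedValue D g (i + 1) = g i + countBelow D (i + 1) := by
  rw [shiftedValue, dif_pos ⟨by omega, i.2⟩]
  rfl

theorem shiftedValue_le (D : Finset (Fin n)) (g : Fin n → Fin (r + 1 - D.card)) (i : ℕ) :
    shiftedValue D g i ≤ r := by
  unfold shiftedValue
  split_ifs with h
  · have h1 := (g ⟨i - 1, by omega⟩).2
    have h2 := countBelow_le D i
    omega
  · exact r.zero_le

/-- The odd labelling obtained from a weakly increasing sequence. -/
def labelling (D : Finset (Fin n)) (g : Fin n → Fin (r + 1 - D.card)) (a : Omega n) : Omega r :=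
  ⟨(a : ℤ).sign * shiftedValue D g (a : ℤ).natAbs, by
    have h := shiftedValue_le D g (a : ℤ).natAbs
    rw [Finset.mem_Icc]
    rcases Int.sign_trichotomy (a : ℤ) with h' | h' | h' <;> rw [h'] <;> constructor <;> omega⟩

theorem labelling_ofNat (D : Finset (Fin n)) (g : Fin n → Fin (r + 1 - D.card)) (i : ℕ)
    (hi : i ≤ n) : (labelling D g (Omega.ofNat i hi) : ℤ) = shiftedValue D g i := by
  simp only [labelling, Omega.ofNat_coe, Int.natAbs_natCast]
  rcases Nat.eq_zero_or_pos i with rfl | h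
  · simp [shiftedValue_zero]
  · rw [Int.sign_eq_one_of_pos (by omega), one_mul]

theorem labelling_neg (D : Finset (Fin n)) (g : Fin n → Fin (r + 1 - D.card)) (a : Omega n) :
    labelling D g a.neg = (labelling D g a).neg :=
  Subtype.ext (by simp [labelling, Omega.neg])

/-- Subtracting the number of preceding descents turns the strict steps into weak ones and lowers
the upper bound from `r` to `r - des π`. -/
theorem bijOn_labelling {π : Equiv.Perm (Omega n)} (hπ : IsSigned π) :
    Set.BijOn (labelling (r := r) (descentSet π)) {g | Monotone g}
      {f | IsCompatible Omega.neg Omega.neg π f} := by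
  refine ⟨fun g hg => ?_, fun g _ g' _ h => ?_, fun f hf => ?_⟩
  · refine (isCompatible_iff hπ _).2 ⟨labelling_neg _ g, fun i => ?_⟩
    rw [labelling_ofNat, labelling_ofNat, shiftedValue_succ, countBelow_succ]
    rcases Nat.eq_zero_or_pos (i : ℕ) with hi | hi
    · rw [hi, shiftedValue_zero]
      split_ifs <;> push_cast <;> omega
    · have h1 := shiftedValue_succ (descentSet π) g ⟨i - 1, by omega⟩
      simp only [show (i : ℕ) - 1 + 1 = i by omega] at h1
      have h2 : (g ⟨i - 1, by omega⟩ : ℕ) ≤ g i :=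
        Fin.le_def.1 (hg (Fin.le_def.2 (by simp)))
      rw [h1]
      split_ifs <;> push_cast <;> omega
  · funext i
    have := congrArg Subtype.val (congrFun h (Omega.ofNat (i + 1) i.2))
    rw [labelling_ofNat, labelling_ofNat, shiftedValue_succ, shiftedValue_succ] at this
    exact Fin.ext (by omega)
  · obtain ⟨hodd, hstep⟩ := (isCompatible_iff hπ f).1 hf
    let q : Fin (n + 1) → ℤ := fun i =>
      (f (Omega.ofNat i (Nat.lt_succ_iff.1 i.2)) : ℤ) - countBelow (descentSet π) i
    have hq : Monotone q := by
      rw [Fin.monotone_iff_le_succ]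
      intro i
      have h1 := hstep i
      have h2 := countBelow_succ (descentSet π) i
      simp only [q, Fin.val_castSucc, Fin.val_succ]
      rw [h2]
      split_ifs at h1 ⊢ <;> push_cast <;> omega
    -- The value at `0` equals its own negative.
    have hf0 : (f (Omega.ofNat 0 n.zero_le) : ℤ) = 0 := by
      have := congrArg Subtype.val (hodd (Omega.ofNat 0 n.zero_le))
      rw [show (Omega.ofNat 0 n.zero_le).neg = Omega.ofNat 0 n.zero_le from rfl,
        Omega.neg_coe] at this
      omega
    have hq0 : q 0 = 0 := by simp [q, hf0, countBelow_zero]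
    have hqn : q (Fin.last n) + (descentSet π).card ≤ r := by
      have := Finset.mem_Icc.1 (f (Omega.ofNat n le_rfl)).2
      simp only [q, Fin.val_last, countBelow_self]
      omega
    have hq0' : ∀ i, 0 ≤ q i := fun i => hq0 ▸ hq (Fin.zero_le i)
    have hqn' : ∀ i, q i + (descentSet π).card ≤ r := fun i =>
      (add_le_add_left (hq (Fin.le_last i)) _).trans hqn
    refine ⟨fun i => ⟨(q i.succ).toNat, ?_⟩, fun i j hij => ?_, ?_⟩
    · have h1 := hq0' i.succ
      have h2 := hqn' i.succ
      omega
    · exact Fin.le_def.2 (Int.toNat_le_toNat (hq (Fin.succ_le_succ_iff.2 hij)))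
    · have hpos : ∀ (i : ℕ) (hi : i ≤ n), labelling (r := r) (descentSet π)
          (fun i => ⟨(q i.succ).toNat, by
            have h1 := hq0' i.succ
            have h2 := hqn' i.succ
            omega⟩) (Omega.ofNat i hi) = f (Omega.ofNat i hi) := by
        intro i hi
        refine Subtype.ext ?_
        rw [labelling_ofNat]
        rcases i with _ | i
        · rw [shiftedValue_zero, hf0]; rfl
        · rw [shiftedValue_succ _ _ ⟨i, hi⟩]
          have h1 := hq0' (Fin.succ ⟨i, hi⟩)
          push_cast
          rw [Int.toNat_of_nonneg h1]
          simp [q]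
      funext a
      rcases le_or_gt 0 (a : ℤ) with ha | ha
      · obtain ⟨m, hm, rfl⟩ := a.exists_ofNat ha
        exact hpos m hm
      · obtain ⟨m, hm, ham⟩ := a.neg.exists_ofNat (by rw [Omega.neg_coe]; omega)
        have h1 := hpos m hm
        rw [← ham, labelling_neg, hodd] at h1
        exact Omega.neg_involutive.injective h1

theorem ncard_isCompatible {π : Equiv.Perm (Omega n)} (hπ : IsSigned π) (r : ℕ) :
    {f : Omega n → Omega r | IsCompatible Omega.neg Omega.neg π f}.ncard =
      (r + 1 - des π).multichoose n := by
  rw [← (bijOn_labelling hπ).image_eq, (bijOn_labelling hπ).injOn.ncard_image, card_monotone_fin]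
  rfl

end Labellings

-- The matrices are counted as compatible pairs and the pairs are fibred over the involution.
open Classical in
theorem ncard_symmMatrices_eq_sum (n r : ℕ) :
    (symmMatrices (Omega.neg (n := r)) (2 * n + 1)).ncard =
      ∑ π ∈ signedInvolutions n, (r + 1 - des π).multichoose n := by
  rw [← Omega.card n, ← ncard_compatiblePairs (ν := Omega.neg) Omega.neg_involutive
    Omega.neg_involutive Omega.neg_antitone Omega.neg_antitone, Set.ncard_eq_toFinset_card',
    Finset.card_eq_sum_card_fiberwise (f := Prod.fst) (t := signedInvolutions n)]
  · refine Finset.sum_congr rfl fun π hπ => ?_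
    simp only [signedInvolutions, signedPerms, Finset.mem_filter, Finset.mem_univ, true_and] at hπ
    rw [← ncard_isCompatible hπ.1, Set.ncard_eq_toFinset_card']
    refine Finset.card_bij (fun p _ => p.2) ?_ ?_ ?_
    · rintro ⟨σ, f⟩ h
      simp only [Finset.mem_filter, Set.mem_toFinset] at h ⊢
      exact h.2 ▸ h.1.2.2
    · rintro ⟨σ, f⟩ h ⟨τ, g⟩ h' he
      simp only [Finset.mem_filter] at h h' he
      rw [h.2, h'.2, he]
    · intro f hf
      refine ⟨(π, f), ?_, rfl⟩
      simp only [Finset.mem_filter, Set.mem_toFinset] at hf ⊢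
      refine ⟨⟨fun a => ?_, hπ.1, hf⟩, trivial⟩
      conv_lhs => rw [← hπ.2]
      rw [hπ.2, ← Equiv.Perm.eq_inv_iff_eq, hπ.2]
  · rintro ⟨π, f⟩ h
    simp only [Set.coe_toFinset] at h
    simp only [signedInvolutions, signedPerms, Finset.coe_filter, Finset.mem_filter,
      Finset.mem_univ, true_and, Set.mem_ofPred_eq]
    refine ⟨h.2.1, ?_⟩
    ext a
    rw [Equiv.Perm.inv_eq_iff_eq.2 (h.1 a).symm]

open PowerSeries

/-! ### The operator `X d/dX` and logarithmic derivatives -/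

section Euler

/-- The operator `X d/dX`. -/
noncomputable def euler (f : ℤ⟦X⟧) : ℤ⟦X⟧ := X * d⁄dX ℤ f

theorem coeff_euler (f : ℤ⟦X⟧) (m : ℕ) : coeff m (euler f) = m * coeff m f := by
  cases m with
  | zero => simp [euler]
  | succ m =>
    rw [euler, coeff_succ_X_mul, coeff_derivative]
    push_cast
    ring

/-- The extra factor `u` avoids the exponent `k - 1`, so `k = 0` is not exceptional. -/
theorem mul_derivative_pow (u : ℤ⟦X⟧) (k : ℕ) :
    u * d⁄dX ℤ (u ^ k) = (k : ℤ⟦X⟧) * u ^ k * d⁄dX ℤ u := by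
  cases k with
  | zero => simp
  | succ k =>
    rw [Derivation.leibniz_pow]
    simp only [smul_eq_mul, nsmul_eq_mul, Nat.add_sub_cancel]
    ring

theorem derivative_one_sub_X : d⁄dX ℤ (1 - X : ℤ⟦X⟧) = -1 := by
  rw [map_sub, derivative_X, Derivation.map_one_eq_zero]
  simp

theorem derivative_one_sub_X_sq : d⁄dX ℤ (1 - X ^ 2 : ℤ⟦X⟧) = -2 * X := by
  rw [map_sub, Derivation.leibniz_pow, derivative_X, Derivation.map_one_eq_zero]
  simp

/-- This is the conjugation rule: multiplication by `(1 - X) ^ m` carries `(1 - X) * euler` to `(1 -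
X) * euler + m * X`. -/
theorem one_sub_mul_euler (m : ℕ) (G : ℤ⟦X⟧) :
    (1 - X) * euler ((1 - X) ^ m * G) =
      (1 - X) ^ (m + 1) * euler G - (m : ℤ⟦X⟧) * (X : ℤ⟦X⟧) * ((1 - X) ^ m * G) := by
  have h := mul_derivative_pow (1 - X) m
  rw [derivative_one_sub_X] at h
  simp only [euler, Derivation.leibniz, smul_eq_mul]
  linear_combination X * G * h

theorem euler_add (f g : ℤ⟦X⟧) : euler (f + g) = euler f + euler g := by
  simp only [euler, map_add, mul_add]

theorem euler_mul (f g : ℤ⟦X⟧) : euler (f * g) = euler f * g + f * euler g := by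
  simp only [euler, Derivation.leibniz, smul_eq_mul]
  ring

theorem euler_X : euler X = X := by simp [euler, derivative_X]

theorem euler_one_sub_X : euler (1 - X) = -X := by
  rw [euler, derivative_one_sub_X]; ring

theorem euler_natCast (n : ℕ) : euler (n : ℤ⟦X⟧) = 0 := by
  rw [euler, ← map_natCast (C (R := ℤ)), derivative_C, mul_zero]

/-- The logarithmic derivative of `1 / ((1 - X) ^ p * (1 - X ^ 2) ^ q)`. -/
theorem derivative_of_mul_eq_one {F : ℤ⟦X⟧} {p q : ℕ}
    (h : F * ((1 - X) ^ p * (1 - X ^ 2) ^ q) = 1) :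
    (1 - X ^ 2) * d⁄dX ℤ F = ((p : ℤ⟦X⟧) * (1 + X) + 2 * (q : ℤ⟦X⟧) * X) * F := by
  have h1 := mul_derivative_pow (1 - X) p
  have h2 := mul_derivative_pow (1 - X ^ 2) q
  rw [derivative_one_sub_X] at h1
  rw [derivative_one_sub_X_sq] at h2
  have h3 := congrArg (d⁄dX ℤ) h
  rw [Derivation.map_one_eq_zero] at h3
  simp only [Derivation.leibniz, smul_eq_mul] at h3
  set S := (1 - X : ℤ⟦X⟧) ^ p
  set T := (1 - X ^ 2 : ℤ⟦X⟧) ^ q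
  -- The product rule gives the identity only after multiplication by the denominator `S * T`; since
  -- `F * (S * T) = 1`, multiplying by `F` then removes it.
  have h4 : ((1 - X ^ 2) * d⁄dX ℤ F - ((p : ℤ⟦X⟧) * (1 + X) + 2 * (q : ℤ⟦X⟧) * X) * F) * (S * T) = 0 := by
    linear_combination (1 - X ^ 2) * h3 - F * T * (1 + X) * h1 - F * S * h2
  have h5 : (1 - X ^ 2) * d⁄dX ℤ F - ((p : ℤ⟦X⟧) * (1 + X) + 2 * (q : ℤ⟦X⟧) * X) * F = 0 := by
    linear_combination F * h4 -
      ((1 - X ^ 2) * d⁄dX ℤ F - ((p : ℤ⟦X⟧) * (1 + X) + 2 * (q : ℤ⟦X⟧) * X) * F) * h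
  exact sub_eq_zero.1 h5

end Euler

/-! ### Coefficients at integer indices -/

section IntegerCoefficients

/-- The coefficient of a power series at an integer. -/
noncomputable def coeffInt (f : ℤ⟦X⟧) (k : ℤ) : ℤ := if 0 ≤ k then coeff k.toNat f else 0

theorem coeffInt_natCast (f : ℤ⟦X⟧) (k : ℕ) : coeffInt f k = coeff k f := by
  simp [coeffInt]

theorem coeffInt_add (f g : ℤ⟦X⟧) (k : ℤ) : coeffInt (f + g) k = coeffInt f k + coeffInt g k := by
  unfold coeffInt
  split_ifs <;> simp

theorem coeffInt_sub (f g : ℤ⟦X⟧) (k : ℤ) : coeffInt (f - g) k = coeffInt f k - coeffInt g k := by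
  unfold coeffInt
  split_ifs <;> simp

theorem coeffInt_intCast_mul (a : ℤ) (f : ℤ⟦X⟧) (k : ℤ) :
    coeffInt ((a : ℤ⟦X⟧) * f) k = a * coeffInt f k := by
  unfold coeffInt
  rw [← eq_intCast (C (R := ℤ)) a, coeff_C_mul]
  split_ifs <;> simp

/-- Extension by zero to negative indices makes the shift valid for every `k`, so recurrences have
no boundary cases. -/
theorem coeffInt_X_mul (f : ℤ⟦X⟧) (k : ℤ) : coeffInt (X * f) k = coeffInt f (k - 1) := by
  unfold coeffInt
  rcases lt_trichotomy k 0 with h | rfl | h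
  · rw [if_neg (by omega), if_neg (by omega)]
  · simp
  · rw [if_pos (by omega), if_pos (by omega), show k.toNat = (k - 1).toNat + 1 by omega,
      coeff_succ_X_mul]

theorem coeffInt_euler (f : ℤ⟦X⟧) (k : ℤ) : coeffInt (euler f) k = k * coeffInt f k := by
  unfold coeffInt
  split_ifs with h
  · rw [coeff_euler]
    congr 1
    omega
  · simp

end IntegerCoefficients

/-! ### Recurrence for the number of invariant matrices -/

/-- The number of invariant matrices of a given size. -/
noncomputable def numMatrices (n r : ℕ) : ℤ :=
  ((symmMatrices (Omega.neg (n := r)) (2 * n + 1)).ncard : ℤ)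

theorem derivative_mk_numMatrices (r : ℕ) :
    (1 - X ^ 2) * d⁄dX ℤ (mk fun n => numMatrices n r) =
      (((2 * r + 1 : ℕ) : ℤ⟦X⟧) * (1 + X) + 2 * ((r ^ 2 : ℕ) : ℤ⟦X⟧) * X) * mk fun n => numMatrices n r :=
  derivative_of_mul_eq_one (mk_ncard_symmMatrices_mul r)

theorem numMatrices_zero (r : ℕ) : numMatrices 0 r = 1 := by
  have h := congrArg (constantCoeff (R := ℤ)) (mk_ncard_symmMatrices_mul r)
  rw [map_mul, ← coeff_zero_eq_constantCoeff_apply, coeff_mk] at h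
  rw [numMatrices]
  simpa only [map_mul, map_pow, map_sub, map_one, constantCoeff_X, ne_eq, OfNat.ofNat_ne_zero,
    not_false_eq_true, zero_pow, sub_zero, one_pow, mul_one] using h

theorem numMatrices_rec_int (r : ℕ) (m : ℤ) :
    (m + 1) * coeffInt (mk fun n => numMatrices n r) (m + 1) =
      (2 * r + 1) * coeffInt (mk fun n => numMatrices n r) m +
      (2 * r ^ 2 + 2 * r + m) * coeffInt (mk fun n => numMatrices n r) (m - 1) := by
  set F : ℤ⟦X⟧ := mk fun n => numMatrices n r with hF
  have h : euler F - X * (X * euler F) =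
      ((2 * r + 1 : ℤ) : ℤ⟦X⟧) * (X * F) +
        ((2 * r ^ 2 + 2 * r + 1 : ℤ) : ℤ⟦X⟧) * (X * (X * F)) := by
    have := derivative_mk_numMatrices r
    rw [← hF] at this
    unfold euler
    push_cast at this ⊢
    linear_combination X * this
  have := congrArg (fun f => coeffInt f (m + 1)) h
  simp only [coeffInt_sub, coeffInt_add, coeffInt_X_mul, coeffInt_euler, coeffInt_intCast_mul] at this
  simp only [add_sub_cancel_right] at this
  linear_combination this

theorem numMatrices_one (r : ℕ) : numMatrices 1 r = 2 * r + 1 := by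
  have h := numMatrices_rec_int r 0
  simpa [coeffInt, numMatrices_zero] using h

theorem numMatrices_add_two (n r : ℕ) :
    ((n : ℤ) + 2) * numMatrices (n + 2) r = (2 * r + 1) * numMatrices (n + 1) r +
      (2 * r ^ 2 + 2 * r + (n + 1)) * numMatrices n r := by
  have h := numMatrices_rec_int r (n + 1 : ℕ)
  rw [show ((n + 1 : ℕ) : ℤ) + 1 = (n + 2 : ℕ) by push_cast; ring,
    show ((n + 1 : ℕ) : ℤ) - 1 = (n : ℕ) by push_cast; ring] at h
  simp only [coeffInt_natCast, coeff_mk] at h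
  push_cast at h
  exact h

/-! ### From matrices to the descent polynomial -/

/-- The descent polynomial of signed involutions. -/
noncomputable def descentSeries (n : ℕ) : ℤ⟦X⟧ := mk fun k => (numInvolutions n k : ℤ)

theorem coeffInt_descentSeries (n : ℕ) (k : ℤ) :
    coeffInt (descentSeries n) k = numInvolutions n k := by
  unfold coeffInt descentSeries
  split_ifs with h
  · rw [coeff_mk, Int.toNat_of_nonneg h]
  · symm
    rw [numInvolutions, Nat.cast_eq_zero, Finset.card_eq_zero, Finset.filter_eq_empty_iff]
    intro π _ hk
    omega

theorem descentSeries_eq_sum (n : ℕ) :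
    descentSeries n = ∑ π ∈ signedInvolutions n, (X : ℤ⟦X⟧) ^ des π := by
  ext k
  simp only [descentSeries, coeff_mk, map_sum, coeff_X_pow, numInvolutions, Finset.sum_boole,
    Nat.cast_inj, eq_comm]

theorem one_sub_X_pow_mul_mk_multichoose {d n : ℕ} (h : d ≤ n) :
    (1 - X : ℤ⟦X⟧) ^ (n + 1) * (mk fun r => ((r + 1 - d).multichoose n : ℤ)) = X ^ d := by
  have h1 : (mk fun r => ((r + 1 - d).multichoose n : ℤ)) = X ^ d * (mk 1 : ℤ⟦X⟧) ^ (n + 1) := by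
    rw [mk_one_pow_eq_mk_choose_add]
    ext r
    rw [coeff_X_pow_mul', coeff_mk]
    split_ifs with hr
    · rw [coeff_mk, Nat.multichoose_eq]
      congr 2
      omega
    -- Here `r < d ≤ n`, so `n` is positive and `multichoose 0 n` vanishes; for `n = 0` it would be
    -- 1.
    · rw [show r + 1 - d = 0 by omega]
      obtain ⟨m, rfl⟩ : ∃ m, n = m + 1 := ⟨n - 1, by omega⟩
      simp
  have h2 : (mk 1 : ℤ⟦X⟧) * (1 - X) = 1 := mk_one_mul_one_sub_eq_one ℤ
  rw [h1, mul_left_comm, ← mul_pow, mul_comm (1 - X), h2, one_pow, mul_one]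

theorem descentSeries_eq (n : ℕ) :
    descentSeries n = (1 - X) ^ (n + 1) * mk fun r => numMatrices n r := by
  have h : (mk fun r => numMatrices n r) =
      ∑ π ∈ signedInvolutions n, mk fun r => ((r + 1 - des π).multichoose n : ℤ) := by
    ext r
    rw [coeff_mk, map_sum, numMatrices, ncard_symmMatrices_eq_sum, Nat.cast_sum]
    simp only [coeff_mk]
  rw [h, Finset.mul_sum, descentSeries_eq_sum]
  refine Finset.sum_congr rfl fun π _ => (one_sub_X_pow_mul_mk_multichoose ?_).symm
  exact (Finset.card_le_univ _).trans_eq (Fintype.card_fin n)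

/-- In the recurrence for `numMatrices`, each factor `r` acts as `euler`; after multiplication by
`(1 - X) ^ (n + 3)` each `euler` becomes some `(1 - X) * euler + m * X`. The term `2 * r ^ 2`
applies this twice, with `m = n + 1` and then `m = n + 2`, the latter written as `n + 3` less one.
-/
theorem descentSeries_rec (n : ℕ) :
    ((n : ℤ⟦X⟧) + 2) * descentSeries (n + 2) =
      2 * ((1 - X) * euler (descentSeries (n + 1)) + ((n : ℤ⟦X⟧) + 2) * X * descentSeries (n + 1)) +
      (1 - X) * descentSeries (n + 1) +
      2 * ((1 - X) * euler ((1 - X) * euler (descentSeries n) + ((n : ℤ⟦X⟧) + 1) * X * descentSeries n) +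
        ((n : ℤ⟦X⟧) + 3) * X * ((1 - X) * euler (descentSeries n) + ((n : ℤ⟦X⟧) + 1) * X * descentSeries n)
        - X * ((1 - X) * euler (descentSeries n) + ((n : ℤ⟦X⟧) + 1) * X * descentSeries n)) +
      2 * (1 - X) * ((1 - X) * euler (descentSeries n) + ((n : ℤ⟦X⟧) + 1) * X * descentSeries n) +
      ((n : ℤ⟦X⟧) + 1) * (1 - X) ^ 2 * descentSeries n := by
  set G : ℕ → ℤ⟦X⟧ := fun n => mk fun r => numMatrices n r with hG
  have hD : ∀ n, descentSeries n = (1 - X) ^ (n + 1) * G n := descentSeries_eq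
  have hrec : ((n : ℤ⟦X⟧) + 2) * G (n + 2) = 2 * euler (G (n + 1)) + G (n + 1) +
      (2 * euler (euler (G n)) + 2 * euler (G n) + ((n : ℤ⟦X⟧) + 1) * G n) := by
    have hn : ∀ (a : ℕ) (f : ℤ⟦X⟧) (r : ℕ), coeff r ((a : ℤ⟦X⟧) * f) = a * coeff r f := by
      intro a f r
      rw [← map_natCast (C (R := ℤ)), coeff_C_mul]
    ext r
    have h := numMatrices_add_two n r
    rw [show (n : ℤ⟦X⟧) + 2 = ((n + 2 : ℕ) : ℤ⟦X⟧) by push_cast; ring,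
      show (n : ℤ⟦X⟧) + 1 = ((n + 1 : ℕ) : ℤ⟦X⟧) by push_cast; ring,
      show (2 : ℤ⟦X⟧) = ((2 : ℕ) : ℤ⟦X⟧) by push_cast; ring]
    simp only [map_add, hn, coeff_euler, hG, coeff_mk]
    push_cast
    linear_combination h
  have h1 := one_sub_mul_euler (n + 2) (G (n + 1))
  have h2 := one_sub_mul_euler (n + 1) (G n)
  have h3 := one_sub_mul_euler (n + 2) (euler (G n))
  have h4 : (1 - X) * euler (descentSeries n) + ((n : ℤ⟦X⟧) + 1) * X * descentSeries n =
      (1 - X) ^ (n + 2) * euler (G n) := by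
    rw [hD]
    push_cast at h2
    linear_combination h2
  rw [h4]
  rw [hD n, hD (n + 1), hD (n + 2)]
  push_cast at h1 h3
  linear_combination (1 - X) ^ (n + 3) * hrec - 2 * h1 - 2 * h3

theorem numInvolutions_rec (n : ℕ) (k : ℤ) :
    ((n : ℤ) + 2) * numInvolutions (n + 2) k =
      (2 * k + 1) * numInvolutions (n + 1) k +
      (2 * n - 2 * k + 5) * numInvolutions (n + 1) (k - 1) +
      (n + 1 + 2 * k * (k + 1)) * numInvolutions n k +
      (2 * (n + 1) + 4 * (n + 1 - k) * (k - 1)) * numInvolutions n (k - 1) +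
      ((2 * n + 1) * (n + 1) + 2 * (k - 2) * (k - 2 * n - 3)) * numInvolutions n (k - 2) := by
  have h := descentSeries_rec n
  set P := descentSeries n with hP
  set Q := descentSeries (n + 1) with hQ
  set R := descentSeries (n + 2) with hR
  have he : euler ((1 - X) * euler P + ((n : ℤ⟦X⟧) + 1) * X * P) =
      -X * euler P + (1 - X) * euler (euler P) + ((n : ℤ⟦X⟧) + 1) * (X * P + X * euler P) := by
    have := euler_natCast (n + 1)
    push_cast at this
    rw [euler_add, euler_mul, euler_mul, euler_mul, euler_X, euler_one_sub_X, this]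
    ring
  rw [he] at h
  -- All powers of `X` are moved to the left of `euler`, so that each term is an integer multiple of
  -- a shifted coefficient.
  have h' : ((n + 2 : ℤ) : ℤ⟦X⟧) * R =
      ((2 : ℤ) : ℤ⟦X⟧) * euler Q - ((2 : ℤ) : ℤ⟦X⟧) * (X * euler Q) + Q +
      ((2 * n + 3 : ℤ) : ℤ⟦X⟧) * (X * Q) +
      ((2 : ℤ) : ℤ⟦X⟧) * euler (euler P) - ((4 : ℤ) : ℤ⟦X⟧) * (X * euler (euler P)) +
      ((2 : ℤ) : ℤ⟦X⟧) * (X * (X * euler (euler P))) +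
      ((2 : ℤ) : ℤ⟦X⟧) * euler P + ((4 * n : ℤ) : ℤ⟦X⟧) * (X * euler P) -
      ((4 * n + 2 : ℤ) : ℤ⟦X⟧) * (X * (X * euler P)) + ((n + 1 : ℤ) : ℤ⟦X⟧) * P +
      ((2 * (n + 1) : ℤ) : ℤ⟦X⟧) * (X * P) +
      (((2 * n + 1) * (n + 1) : ℤ) : ℤ⟦X⟧) * (X * (X * P)) := by
    push_cast
    linear_combination h
  have := congrArg (fun f => coeffInt f k) h'
  simp only [coeffInt_sub, coeffInt_add, coeffInt_X_mul, coeffInt_euler, coeffInt_intCast_mul,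
    hP, hQ, hR, coeffInt_descentSeries] at this
  rw [show k - 1 - 1 = k - 2 by ring] at this
  linear_combination this

theorem numInvolutions_of_neg (n : ℕ) {k : ℤ} (hk : k < 0) : numInvolutions n k = 0 := by
  have := coeffInt_descentSeries n k
  rw [coeffInt, if_neg (by omega)] at this
  exact_mod_cast this.symm

theorem numInvolutions_one (k : ℤ) : (numInvolutions 1 k : ℤ) =
    coeffInt (mk fun r => numMatrices 1 r) k - 2 * coeffInt (mk fun r => numMatrices 1 r) (k - 1) +
      coeffInt (mk fun r => numMatrices 1 r) (k - 2) := by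
  rw [← coeffInt_descentSeries, descentSeries_eq]
  generalize (mk fun r => numMatrices 1 r) = G
  have : (1 - X) ^ (1 + 1) * G = G - ((2 : ℤ) : ℤ⟦X⟧) * (X * G) + X * (X * G) := by
    push_cast; ring
  rw [this]
  simp only [coeffInt_sub, coeffInt_add, coeffInt_X_mul, coeffInt_intCast_mul]
  rw [show k - 1 - 1 = k - 2 by ring]

theorem numInvolutions_two (k : ℤ) : (numInvolutions 2 k : ℤ) =
    coeffInt (mk fun r => numMatrices 2 r) k - 3 * coeffInt (mk fun r => numMatrices 2 r) (k - 1) +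
      3 * coeffInt (mk fun r => numMatrices 2 r) (k - 2) -
      coeffInt (mk fun r => numMatrices 2 r) (k - 3) := by
  rw [← coeffInt_descentSeries, descentSeries_eq]
  generalize (mk fun r => numMatrices 2 r) = G
  have : (1 - X) ^ (2 + 1) * G = G - ((3 : ℤ) : ℤ⟦X⟧) * (X * G) +
      ((3 : ℤ) : ℤ⟦X⟧) * (X * (X * G)) - X * (X * (X * G)) := by
    push_cast; ring
  rw [this]
  simp only [coeffInt_sub, coeffInt_add, coeffInt_X_mul, coeffInt_intCast_mul]
  rw [show k - 1 - 1 = k - 2 by ring, show k - 2 - 1 = k - 3 by ring]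

theorem numMatrices_two (r : ℕ) : numMatrices 2 r = 3 * r ^ 2 + 3 * r + 1 := by
  have h := numMatrices_add_two 0 r
  simp only [zero_add, numMatrices_zero, numMatrices_one, Nat.cast_zero] at h
  linarith

end SignedPerm

theorem mainTheorem4 :
    (∀ (n : ℕ) (k : ℤ), 3 ≤ n → 0 ≤ k →
      (n : ℤ) * (SignedPerm.numInvolutions n k : ℤ) =
        (2 * k + 1) * (SignedPerm.numInvolutions (n - 1) k : ℤ)
        + (2 * (n : ℤ) - 2 * k + 1) * (SignedPerm.numInvolutions (n - 1) (k - 1) : ℤ)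
        + ((n : ℤ) - 1 + 2 * k * (k + 1)) * (SignedPerm.numInvolutions (n - 2) k : ℤ)
        + (2 * ((n : ℤ) - 1) + 4 * ((n : ℤ) - k - 1) * (k - 1))
          * (SignedPerm.numInvolutions (n - 2) (k - 1) : ℤ)
        + ((2 * (n : ℤ) - 3) * ((n : ℤ) - 1) + 2 * (k - 2) * (k - 2 * (n : ℤ) + 1))
          * (SignedPerm.numInvolutions (n - 2) (k - 2) : ℤ)) ∧
    SignedPerm.numInvolutions 1 0 = 1 ∧
    SignedPerm.numInvolutions 1 1 = 1 ∧
    SignedPerm.numInvolutions 2 0 = 1 ∧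
    SignedPerm.numInvolutions 2 1 = 4 ∧
    SignedPerm.numInvolutions 2 2 = 1 ∧
    (∀ (n : ℕ) (k : ℤ), 1 ≤ n → k < 0 → SignedPerm.numInvolutions n k = 0) := by
  
  refine ⟨fun n k hn _ => ?_, ?_, ?_, ?_, ?_, ?_, fun n k _ hk =>
    SignedPerm.numInvolutions_of_neg n hk⟩
  · obtain ⟨m, rfl⟩ : ∃ m, n = m + 2 := ⟨n - 2, by omega⟩
    have h := SignedPerm.numInvolutions_rec m k
    rw [show m + 2 - 1 = m + 1 by omega, show m + 2 - 2 = m by omega]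
    push_cast
    linear_combination h
  -- The initial values are differences of `2 * r + 1` for `n = 1` and of `3 * r ^ 2 + 3 * r + 1`
  -- for `n = 2`.
  · have h := SignedPerm.numInvolutions_one 0
    simp [SignedPerm.coeffInt, SignedPerm.numMatrices_one] at h
    omega
  · have h := SignedPerm.numInvolutions_one 1
    simp [SignedPerm.coeffInt, SignedPerm.numMatrices_one] at h
    omega
  · have h := SignedPerm.numInvolutions_two 0
    simp [SignedPerm.coeffInt, SignedPerm.numMatrices_two] at h
    omega
  · have h := SignedPerm.numInvolutions_two 1
    simp [SignedPerm.coeffInt, SignedPerm.numMatrices_two] at h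
    omega
  · have h := SignedPerm.numInvolutions_two 2
    simp [SignedPerm.coeffInt, SignedPerm.numMatrices_two] at h
    omega
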